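/- **Theorem 4.5.** Let $d\in\{2,3\}$, let $\Omega\subset\mathbb R^d$ be a bounded polyhedral domain with Lipschitz boundary, let $1<p<\infty$, $f\in L^{p/(p-1)}(\Omega)$ and $\psi\in C(\overline\Omega)$. Put $$F(v)=\frac1p\int_\Omega|\nabla v|^p\,dx-\int_\Omega fv\,dx,\qquad \langle F'(v),w\rangle=\int_\Omega|\nabla v|^{p-2}\nabla v\cdot\nabla w\,dx-\int_\Omega fw\,dx,$$ $$D_F(u,v)=F(u)-F(v)-\langle F'(v),u-v\rangle,\qquad \Phi(u,v)=\int_\Omega\big(|\nabla(u-v)|+|\nabla v|\big)^{p-2}|\nabla(u-v)|^2\,dx .$$ For a conforming triangulation $\mathcal T_h$ of $\Omega$ let $S_h(\Omega)$ be the space of continuous functions on $\overline\Omega$ that are affine on each element of $\mathcal T_h$ and vanish on $\partial\Omega$. (i) There is a constant $\mu_\Phi>0$, independent of $\mathcal T_h$, such that for every triangulation $\mathcal T_h$ of $\Omega$ $$\mu_\Phi\,\Phi(u,v)\le D_F(u,v)\qquad\text{for all }u,v\in S_h(\Omega).$$ (ii) Let $\mathcal T_h$ be a triangulation of $\Omega$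 that refines another triangulation $\mathcal T_H$ of $\Omega$, and let $V=S_h(\Omega)$. Let $\Omega$ be decomposed into nonoverlapping nonempty subdomains $\Omega_1,\dots,\Omega_N$, each a union of elements of $\mathcal T_H$; for $\delta>0$ let $\Omega_k'$ be the (interior of the) union of all $T\in\mathcal T_h$ with $\operatorname{dist}(T,\Omega_k)\le\delta$. Let $V_0=S_H(\Omega)$ (defined like $S_h(\Omega)$, with $\mathcal T_H$) and, for $1\le k\le N$, let $V_k=S_h(\Omega_k')$ be the space of continuous functions on $\overline{\Omega_k'}$ that are affine on each element of $\mathcal T_h$ in $\overline{\Omega_k'}$ and vanish on $\partial\Omega_k'$. Let $R_0^*:V_0\to V$ be the natural inclusion (nodal interpolation) and $R_k^*:V_k\to V$, $1\le k\le N$, the extension by zero. Let $N_c$ be the least number of colors with which $\Omega_1',\dots,\Omega_N'$ can be colored so that distinct subdomains of the same color do not intersect, and $\tau_0=1/(N_c+1)$. Let $K_h=\{v\in V: v\ge\psi\text{ a.e. in }\Omega\}$. Let $\mu_\Phi>0$ be any constant such that $\mu_\Phi\Phi(u,v)\le D_F(u,v)$ for all $u,v\in V$. Assume that $C_0>0$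 is such that for all $u,v\in K_h$ there are $w_k\in V_k$, $0\le k\le N$, with $$u-v=\sum_{k=0}^NR_k^*w_k,\qquad v+R_k^*w_k\in K_h\ (0\le k\le N),\qquad \sum_{k=0}^ND_F(v+R_k^*w_k,v)\le C_0\,\Phi(u,v).$$ Let $u^*\in K_h$ minimize $F$ over $K_h$, let $\tau\in(0,\tau_0]$ and $u^{(0)}\in K_h$, and for $n\ge0$ let $$w_k^{(n+1)}\in\operatorname*{argmin}_{w_k\in V_k,\ u^{(n)}+R_k^*w_k\in K_h}F\big(u^{(n)}+R_k^*w_k\big)\quad(0\le k\le N),\qquad u^{(n+1)}=u^{(n)}+\tau\sum_{k=0}^NR_k^*w_k^{(n+1)}.$$ Then $u^{(n)}\in K_h$ for all $n\ge0$, and with $\underline p=\min\{p,2\}$, $\overline p=\max\{p,2\}$ and $$\rho=1-\Big(1-\frac1{\underline p}\Big)\min\Big\{\tau,\Big(\frac{\tau^{\overline p-1}\mu_\Phi}{2^{|p-2|}C_0}\Big)^{\frac1{\underline p-1}}\Big\}$$ we have $\rho<1$ and $$F(u^{(n+1)})-F(u^*)\le\rho\,\big(F(u^{(n)})-F(u^*)\big)\qquad\text{for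 all }n\ge0 .$$ -/

import Mathlib

open MeasureTheory Set Topology
open scoped Gradient

noncomputable section

namespace PLap

/-- The space `ℝ^d` with its Euclidean norm and Lebesgue measure. -/
abbrev E (d : ℕ) : Type := EuclideanSpace ℝ (Fin d)

variable {d : ℕ}

/-- A bounded domain with Lipschitz boundary: near each boundary point `Ω` is the set of points
strictly above the graph, in some unit direction `e`, of a Lipschitz function of the
coordinates orthogonal to `e`. -/
structure IsLipschitzDomain (Ω : Set (E d)) : Prop where
  isOpen : IsOpen Ω
  isConnected : IsConnected Ω
  isBounded : Bornology.IsBounded Ω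
  localGraph : ∀ x ∈ frontier Ω, ∃ (ε : ℝ) (e : E d) (g : E d → ℝ) (L : NNReal),
    0 < ε ∧ ‖e‖ = 1 ∧ LipschitzWith L g ∧ (∀ (y : E d) (t : ℝ), g (y + t • e) = g y) ∧
      ∀ y ∈ Metric.ball x ε, (y ∈ Ω ↔ g y < inner ℝ e y)

/-- A conforming triangulation of `Ω`: a finite simplicial complex with underlying space the
closure of `Ω`, all of whose faces are faces of nondegenerate `d`-simplices of the complex.
(So a domain that has a triangulation is polyhedral.) -/
structure Triangulation (Ω : Set (E d)) where
  complex : Geometry.SimplicialComplex ℝ (E d)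
  finite : complex.faces.Finite
  pure : ∀ s ∈ complex.faces, ∃ t ∈ complex.faces, s ⊆ t ∧ t.card = d + 1
  space_eq : complex.space = closure Ω

/-- The elements (closed `d`-simplices) of a triangulation, given by their vertex sets; the
element itself is `convexHull ℝ s`. -/
def Triangulation.elements {Ω : Set (E d)} (T : Triangulation Ω) : Set (Finset (E d)) :=
  {s | s ∈ T.complex.faces ∧ s.card = d + 1}

/-- Continuous functions that are affine on every element of the triangulation `T` and vanish
outside the set `D`. Finite element functions are represented by their extension by zero to the
whole space. -/
def Triangulation.feSpace {Ω : Set (E d)} (T : Triangulation Ω) (D : Set (E d)) :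
    Submodule ℝ (E d → ℝ) where
  carrier := {v | Continuous v ∧ (∀ x, x ∉ D → v x = 0) ∧
    ∀ s ∈ T.elements, ∃ a : E d →ᵃ[ℝ] ℝ, EqOn v a (convexHull ℝ (s : Set (E d)))}
  zero_mem' := ⟨continuous_const, fun _ _ => rfl, fun _ _ => ⟨0, fun _ _ => rfl⟩⟩
  add_mem' := by
    rintro v w ⟨hv, hv0, hva⟩ ⟨hw, hw0, hwa⟩
    refine ⟨hv.add hw, fun x hx => by simp [hv0 x hx, hw0 x hx], fun s hs => ?_⟩
    obtain ⟨a, ha⟩ := hva s hs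
    obtain ⟨b, hb⟩ := hwa s hs
    exact ⟨a + b, fun x hx => by simp [ha hx, hb hx]⟩
  smul_mem' := by
    rintro c v ⟨hv, hv0, hva⟩
    refine ⟨hv.const_smul c, fun x hx => by simp [hv0 x hx], fun s hs => ?_⟩
    obtain ⟨a, ha⟩ := hva s hs
    exact ⟨c • a, fun x hx => by simp [ha hx]⟩

/-- The `P₁` finite element space on the triangulation `T`: continuous, piecewise linear functions
vanishing on the boundary of `Ω` (and extended by zero). -/
def Triangulation.S {Ω : Set (E d)} (T : Triangulation Ω) : Submodule ℝ (E d → ℝ) :=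
  T.feSpace Ω

/-! ### The energy functional, its derivative, the Bregman distance, and `Φ` -/

/-- `F(v) = (1/p) ∫_Ω |∇v|^p dx - ∫_Ω f v dx`. It is used on piecewise linear functions, whose
classical gradient exists a.e. and is the weak gradient. -/
def energy (Ω : Set (E d)) (p : ℝ) (f v : E d → ℝ) : ℝ :=
  1 / p * (∫ x in Ω, ‖∇ v x‖ ^ p) - ∫ x in Ω, f x * v x

/-- `⟨F'(v), w⟩ = ∫_Ω |∇v|^(p-2) ∇v · ∇w dx - ∫_Ω f w dx`; the integrand is `0` where `∇v = 0`. -/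
def energyDeriv (Ω : Set (E d)) (p : ℝ) (f v w : E d → ℝ) : ℝ :=
  (∫ x in Ω, ‖∇ v x‖ ^ (p - 2) * inner ℝ (∇ v x) (∇ w x)) - ∫ x in Ω, f x * w x

/-- The Bregman distance `D_F(u, v) = F(u) - F(v) - ⟨F'(v), u - v⟩`. -/
def bregman (Ω : Set (E d)) (p : ℝ) (f u v : E d → ℝ) : ℝ :=
  energy Ω p f u - energy Ω p f v - energyDeriv Ω p f v (u - v)

/-- `Φ(u, v) = ∫_Ω (|∇(u-v)| + |∇v|)^(p-2) |∇(u-v)|^2 dx`; the integrand is `0` where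
`∇(u-v) = 0`. -/
def Phi (Ω : Set (E d)) (p : ℝ) (u v : E d → ℝ) : ℝ :=
  ∫ x in Ω, (‖∇ (u - v) x‖ + ‖∇ v x‖) ^ (p - 2) * ‖∇ (u - v) x‖ ^ 2

/-! ### Two-level overlapping domain decomposition -/

/-- The data of a two-level overlapping domain decomposition of `Ω`: a coarse triangulation, a
fine triangulation refining it, a distribution of the coarse elements among `N` nonempty
nonoverlapping subdomains, and the overlap width `δ`. The values of `part` on finite sets which
are not coarse elements play no role. -/
structure TwoLevel (Ω : Set (E d)) where
  fine : Triangulation Ω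
  coarse : Triangulation Ω
  refines : ∀ s ∈ fine.elements, ∃ t ∈ coarse.elements,
    convexHull ℝ (s : Set (E d)) ⊆ convexHull ℝ (t : Set (E d))
  N : ℕ
  part : Finset (E d) → Fin N
  part_surj : ∀ k, ∃ s ∈ coarse.elements, part s = k
  δ : ℝ
  δ_pos : 0 < δ

namespace TwoLevel

variable {Ω : Set (E d)} (D : TwoLevel Ω)

/-- The (closed) nonoverlapping subdomain `Ω_k`, a union of coarse elements. -/
def subdomain (k : Fin D.N) : Set (E d) :=
  ⋃ s ∈ {s | s ∈ D.coarse.elements ∧ D.part s = k}, convexHull ℝ (s : Set (E d))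

/-- The union of the fine elements `T` with `dist(T, Ω_k) ≤ δ`. As both sets are compact, the
distance is attained. -/
def enlargedClosed (k : Fin D.N) : Set (E d) :=
  ⋃ s ∈ {s | s ∈ D.fine.elements ∧
    ∃ x ∈ convexHull ℝ (s : Set (E d)), ∃ y ∈ D.subdomain k, dist x y ≤ D.δ},
    convexHull ℝ (s : Set (E d))

/-- The enlarged overlapping subdomain `Ω_k'` (an open set). -/
def enlarged (k : Fin D.N) : Set (E d) :=
  interior (D.enlargedClosed k)

/-- The global fine space `V = S_h(Ω)`. -/
def V : Submodule ℝ (E d → ℝ) := D.fine.S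

/-- `V_0 = S_H(Ω)` and `V_k = S_h(Ω_k')` for `1 ≤ k ≤ N`. Since finite element functions are
represented by their extension by zero, and `S_H(Ω) ⊆ S_h(Ω)`, the prolongations
`R_k^* : V_k → V` (extension by zero for `k ≥ 1`, interpolation for `k = 0`) are the inclusions,
see `localSpace_le`. -/
def localSpace (k : Fin (D.N + 1)) : Submodule ℝ (E d → ℝ) :=
  Fin.cases D.coarse.S (fun j => D.fine.feSpace (D.enlarged j)) k

/-- The least number of colors for `{Ω_k'}` such that distinct subdomains of the same color do not
intersect. -/
def numColors : ℕ :=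
  sInf {c | ∃ col : Fin D.N → Fin c, ∀ k l, k ≠ l → col k = col l →
    Disjoint (D.enlarged k) (D.enlarged l)}

/-- `τ₀ = 1 / (N_c + 1)`. -/
def tau0 : ℝ := 1 / ((D.numColors : ℝ) + 1)

/-- `K_h = K ∩ V` with `K = {v ∈ W_0^{1,p}(Ω) : v ≥ ψ a.e. in Ω}`; recall that every function in
`V` is Lipschitz and vanishes outside `Ω`, so it is in `W_0^{1,p}(Ω)`. -/
def Kh (ψ : E d → ℝ) : Set (E d → ℝ) :=
  {v | v ∈ D.V ∧ ∀ᵐ x ∂(volume.restrict Ω), ψ x ≤ v x}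

/-- The constrained stable decomposition property with constant `C₀`. -/
def StableDecomposition (p : ℝ) (f ψ : E d → ℝ) (C₀ : ℝ) : Prop :=
  ∀ u ∈ D.Kh ψ, ∀ v ∈ D.Kh ψ, ∃ w : Fin (D.N + 1) → (E d → ℝ),
    (∀ k, w k ∈ D.localSpace k) ∧ u - v = ∑ k, w k ∧ (∀ k, v + w k ∈ D.Kh ψ) ∧
      ∑ k, bregman Ω p f (v + w k) v ≤ C₀ * Phi Ω p u v

/-- `u` is a solution of the discrete obstacle problem `min_{u ∈ K_h} F(u)`. -/
def IsSolution (p : ℝ) (f ψ u : E d → ℝ) : Prop :=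
  u ∈ D.Kh ψ ∧ ∀ v ∈ D.Kh ψ, energy Ω p f u ≤ energy Ω p f v

/-- `w` belongs to `argmin {F(v + w) : w ∈ V_k, v + w ∈ K_h}`. -/
def IsLocalCorrection (p : ℝ) (f ψ v : E d → ℝ) (k : Fin (D.N + 1)) (w : E d → ℝ) : Prop :=
  w ∈ D.localSpace k ∧ v + w ∈ D.Kh ψ ∧
    ∀ w' ∈ D.localSpace k, v + w' ∈ D.Kh ψ → energy Ω p f (v + w) ≤ energy Ω p f (v + w')

/-- `u n` (`n ≥ 0`) is a sequence of iterates of the constrained two-level additive Schwarz method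
with step size `τ`, and `w (n + 1) k` are the local corrections computed in step `n`. -/
structure IsSchwarzSequence (p : ℝ) (f ψ : E d → ℝ) (τ : ℝ) (u : ℕ → E d → ℝ)
    (w : ℕ → Fin (D.N + 1) → E d → ℝ) : Prop where
  init : u 0 ∈ D.Kh ψ
  correction : ∀ n k, D.IsLocalCorrection p f ψ (u n) k (w (n + 1) k)
  update : ∀ n, u (n + 1) = u n + τ • ∑ k, w (n + 1) k

/-! ### The local spaces are subspaces of `V` -/

theorem _root_.PLap.IsLipschitzDomain.interior_closure_subset {Ω : Set (E d)}
    (hΩ : IsLipschitzDomain Ω) : interior (closure Ω) ⊆ Ω := by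
  intro x hx
  by_contra hxΩ
  have hfr : x ∈ frontier Ω := by
    rw [hΩ.isOpen.frontier_eq]; exact ⟨interior_subset hx, hxΩ⟩
  obtain ⟨ε, e, g, L, hε, he, hg, hge, hgr⟩ := hΩ.localGraph x hfr
  have hx1 : inner ℝ e x ≤ g x := by
    by_contra h
    exact hxΩ ((hgr x (Metric.mem_ball_self hε)).2 (not_le.1 h))
  obtain ⟨r, hr, hball⟩ := Metric.mem_nhds_iff.1 (mem_interior_iff_mem_nhds.1 hx)
  set t := min ε r / 2 with ht
  have hm : 0 < min ε r := lt_min hε hr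
  have htpos : 0 < t := by positivity
  have hd : dist (x + (-t) • e) x = t := by
    simp [dist_eq_norm, norm_smul, he, abs_of_pos htpos]
  have h1 : x + (-t) • e ∈ Metric.ball x ε := by
    rw [Metric.mem_ball, hd]; linarith [min_le_left ε r]
  have h2 : x + (-t) • e ∈ closure Ω := by
    apply hball; rw [Metric.mem_ball, hd]; linarith [min_le_right ε r]
  have h3 : inner ℝ e (x + (-t) • e) < g (x + (-t) • e) := by
    rw [hge, inner_add_right, inner_smul_right, real_inner_self_eq_norm_sq, he]
    linarith
  have hopen : IsOpen {y | inner ℝ e y < g y} :=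
    isOpen_lt (by fun_prop) hg.continuous
  obtain ⟨y, ⟨hy1, hy2⟩, hyΩ⟩ := mem_closure_iff.1 h2 _ (hopen.inter Metric.isOpen_ball) ⟨h3, h1⟩
  have := (hgr y hy2).1 hyΩ
  change inner ℝ e y < g y at hy1
  linarith

theorem enlarged_subset (hΩ : IsLipschitzDomain Ω) (k : Fin D.N) : D.enlarged k ⊆ Ω := by
  refine (interior_mono ?_).trans hΩ.interior_closure_subset
  intro x hx
  simp only [enlargedClosed, mem_iUnion] at hx
  obtain ⟨s, hs, hxs⟩ := hx
  rw [← D.fine.space_eq]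
  exact D.fine.complex.convexHull_subset_space hs.1.1 hxs

/-- Every local space is contained in `V`. -/
theorem localSpace_le (hΩ : IsLipschitzDomain Ω) (k : Fin (D.N + 1)) : D.localSpace k ≤ D.V := by
  intro v hv
  refine Fin.cases (motive := fun k => v ∈ D.localSpace k → v ∈ D.V) ?_ ?_ k hv
  · rintro ⟨h1, h2, h3⟩
    refine ⟨h1, h2, fun s hs => ?_⟩
    obtain ⟨t, ht, hst⟩ := D.refines s hs
    obtain ⟨a, ha⟩ := h3 t ht
    exact ⟨a, ha.mono hst⟩
  · rintro j ⟨h1, h2, h3⟩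
    exact ⟨h1, fun x hx => h2 x fun hx' => hx (D.enlarged_subset hΩ j hx'), h3⟩

end TwoLevel

end PLap

end

/-! ### Gradients of piecewise affine functions -/

namespace PLap

/-! Gradients of finite element functions are constant on element interiors, so every integral
reduces to a statement about vectors. Part (i) integrates a pointwise bound for the Bregman distance
of `‖·‖^p / p` (`exists_bregman_norm_rpow_ge`), whose constant knows nothing of the mesh; the load
term cancels.

For part (ii), corrections of one color have disjoint supports, so their sum is admissible and their
energy decreases add up. The coarse correction and one sum per color make `N_c + 1` admissible
corrections; as `τ (N_c + 1) ≤ 1`, Jensen's inequality gives `F(u⁺) - F(u) ≤ τ ∑ (F(u + y_k) -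
F(u))` (`add_smul_sum_mem_and_energy_le`).

Local minimality allows each `y_k` to be replaced by the piece `w_k` of a stable decomposition of `t
(u* - u)`. The right-hand sum is then at most `t ⟨F'(u), u* - u⟩ + C₀ Φ(u + t (u* - u), u)`. With `q
= min p 2 > 1`, the last term is at most `C₀ t^q Φ(u*, u)`, hence at most `t μ Φ(u*, u) ≤ t D_F(u*,
u)` once `C₀ t^(q-1) ≤ μ`. The total is `-t (F(u) - F(u*))`, so the error contracts by `1 - τ t`
(`energy_step_le`). The best such `t ≤ 1` gives a rate no worse than `ρ` (`rate_le`). -/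

theorem gradient_add_of_differentiableAt {d : ℕ} {u v : E d → ℝ} {x : E d}
    (hu : DifferentiableAt ℝ u x) (hv : DifferentiableAt ℝ v x) :
    ∇ (u + v) x = ∇ u x + ∇ v x := by
  simp only [gradient, fderiv_add hu hv, map_add]

theorem gradient_smul_of_differentiableAt {d : ℕ} {u : E d → ℝ} {x : E d}
    (hu : DifferentiableAt ℝ u x) (c : ℝ) : ∇ (c • u) x = c • ∇ u x := by
  simp only [gradient, fderiv_const_smul hu, map_smulₛₗ, RCLike.conj_to_real]

namespace Triangulation

variable {d : ℕ} {Ω : Set (E d)} (T : Triangulation Ω)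

theorem elements_finite : T.elements.Finite := T.finite.subset fun _ h => h.1

/-- Almost every point of `Ω` is interior to an element. -/
theorem ae_mem_interior : ∀ᵐ x ∂(volume.restrict Ω), ∃ s ∈ T.elements,
    x ∈ interior (convexHull ℝ (s : Set (E d))) := by
  have h0 : ∀ᵐ x ∂(volume : Measure (E d)), ∀ s ∈ T.elements,
      x ∉ frontier (convexHull ℝ (s : Set (E d))) := by
    rw [ae_ball_iff T.elements_finite.countable]
    intro s _
    exact measure_eq_zero_iff_ae_notMem.1 ((convex_convexHull ℝ _).addHaar_frontier _)
  -- Passing to the closure avoids any measurability of `Ω` and matches `T.space_eq`.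
  have hmem : ∀ᵐ x ∂(volume.restrict Ω), x ∈ closure Ω :=
    ae_mono (Measure.restrict_mono_set _ subset_closure)
      (ae_restrict_mem isClosed_closure.measurableSet)
  filter_upwards [hmem, ae_restrict_of_ae h0] with x hx hfr
  rw [← T.space_eq, Geometry.SimplicialComplex.mem_space_iff] at hx
  obtain ⟨s, hs, hxs⟩ := hx
  obtain ⟨t, ht, hst, hcard⟩ := T.pure s hs
  refine ⟨t, ⟨ht, hcard⟩, ?_⟩
  by_contra h
  exact hfr t ⟨ht, hcard⟩ ⟨subset_closure (convexHull_mono (by exact_mod_cast hst) hxs), h⟩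

/-- A function which is constant in the interior of every element is integrable. -/
theorem integrableOn_of_const {g : E d → ℝ}
    (hg : ∀ s ∈ T.elements, ∃ c, ∀ x ∈ interior (convexHull ℝ (s : Set (E d))), g x = c) :
    IntegrableOn g Ω := by
  have h1 : IntegrableOn g (⋃ s ∈ T.elements, interior (convexHull ℝ (s : Set (E d)))) := by
    rw [integrableOn_finite_biUnion T.elements_finite]
    intro s hs
    obtain ⟨c, hc⟩ := hg s hs
    have hfin : volume (interior (convexHull ℝ (s : Set (E d)))) ≠ ⊤ :=
      (((s.finite_toSet.isCompact_convexHull ℝ).isBounded.subset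
        interior_subset).measure_lt_top).ne
    exact (integrableOn_const hfin).congr_fun (fun x hx => (hc x hx).symm)
      isOpen_interior.measurableSet
  -- Restricting `volume.restrict Ω` further to the union of the element interiors changes nothing,
  -- since almost every point of `Ω` lies in that union.
  have h2 := h1.integrable.mono_measure (Measure.restrict_mono_measure
    (Measure.restrict_le_self (μ := volume) (s := Ω)) _)
  rwa [Measure.restrict_eq_self_of_ae_mem] at h2
  filter_upwards [T.ae_mem_interior] with x hx
  simpa using hx

variable {T} {u v : E d → ℝ}

/-- Finite element functions have constant gradient in the interior of each element. -/
theorem exists_hasGradientAt (hv : v ∈ T.S) {s : Finset (E d)} (hs : s ∈ T.elements) :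
    ∃ g : E d, ∀ x ∈ interior (convexHull ℝ (s : Set (E d))), HasGradientAt v g x := by
  obtain ⟨a, ha⟩ := hv.2.2 s hs
  refine ⟨(InnerProductSpace.toDual ℝ (E d)).symm a.linear.toContinuousLinearMap,
    fun x hx => ?_⟩
  have h1 : HasGradientAt (a : E d → ℝ)
      ((InnerProductSpace.toDual ℝ (E d)).symm a.linear.toContinuousLinearMap) x := by
    rw [hasGradientAt_iff_hasFDerivAt, LinearIsometryEquiv.apply_symm_apply]
    have h := (a.linear.toContinuousLinearMap.hasFDerivAt (x := x)).add_const (a 0)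
    refine h.congr_of_eventuallyEq (Filter.Eventually.of_forall fun y => ?_)
    have := a.decomp
    rw [this]
    simp
  refine h1.congr_of_eventuallyEq ?_
  filter_upwards [isOpen_interior.mem_nhds hx] with y hy
  exact ha (interior_subset hy)

theorem ae_differentiableAt (hv : v ∈ T.S) :
    ∀ᵐ x ∂(volume.restrict Ω), DifferentiableAt ℝ v x := by
  filter_upwards [T.ae_mem_interior] with x ⟨s, hs, hx⟩
  obtain ⟨g, hg⟩ := exists_hasGradientAt hv hs
  exact (hg x hx).differentiableAt

/-- No regularity of `G` is needed: up to a null set the integrand takes finitely many values. This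
covers the weights with negative exponents as well. -/
theorem integrableOn_comp_gradient (hu : u ∈ T.S)
    (hv : v ∈ T.S) (G : E d → E d → ℝ) : IntegrableOn (fun x => G (∇ u x) (∇ v x)) Ω := by
  refine T.integrableOn_of_const fun s hs => ?_
  obtain ⟨g, hg⟩ := exists_hasGradientAt hu hs
  obtain ⟨g', hg'⟩ := exists_hasGradientAt hv hs
  exact ⟨G g g', fun x hx => by rw [(hg x hx).gradient, (hg' x hx).gradient]⟩

theorem ae_gradient_add (hu : u ∈ T.S) (hv : v ∈ T.S) :
    ∀ᵐ x ∂(volume.restrict Ω), ∇ (u + v) x = ∇ u x + ∇ v x := by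
  filter_upwards [ae_differentiableAt hu, ae_differentiableAt hv] with x h1 h2
  exact gradient_add_of_differentiableAt h1 h2

theorem ae_gradient_smul (hu : u ∈ T.S) (c : ℝ) :
    ∀ᵐ x ∂(volume.restrict Ω), ∇ (c • u) x = c • ∇ u x := by
  filter_upwards [ae_differentiableAt hu] with x h1
  exact gradient_smul_of_differentiableAt h1 c

theorem ae_gradient_sub (hu : u ∈ T.S) (hv : v ∈ T.S) :
    ∀ᵐ x ∂(volume.restrict Ω), ∇ (u - v) x = ∇ u x - ∇ v x := by
  filter_upwards [ae_gradient_add (T.S.sub_mem hu hv) hv] with x h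
  rw [sub_add_cancel] at h
  rw [h, add_sub_cancel_right]

theorem ae_gradient_sum {ι : Type*} (A : Finset ι) {y : ι → E d → ℝ} (hy : ∀ i ∈ A, y i ∈ T.S) :
    ∀ᵐ x ∂(volume.restrict Ω), ∇ (∑ i ∈ A, y i) x = ∑ i ∈ A, ∇ (y i) x := by
  classical
  induction A using Finset.induction_on with
  | empty =>
    refine Filter.Eventually.of_forall fun x => ?_
    simp only [Finset.sum_empty]
    exact gradient_fun_const x 0
  | insert a A ha ih =>
    have h1 := fun i hi => hy i (Finset.mem_insert_of_mem hi)
    filter_upwards [ih h1, ae_gradient_add (hy a (Finset.mem_insert_self _ _))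
      (T.S.sum_mem h1)] with x h2 h3
    rw [Finset.sum_insert ha, Finset.sum_insert ha, h3, h2]

/-- Finite element functions with disjoint supports have gradients with a.e. disjoint supports. -/
theorem ae_gradient_eq_zero_or (hu : u ∈ T.S) (hv : v ∈ T.S) (h : ∀ x, u x = 0 ∨ v x = 0) :
    ∀ᵐ x ∂(volume.restrict Ω), ∇ u x = 0 ∨ ∇ v x = 0 := by
  filter_upwards [T.ae_mem_interior] with x ⟨s, hs, hx⟩
  obtain ⟨g, hg⟩ := exists_hasGradientAt hu hs
  obtain ⟨g', hg'⟩ := exists_hasGradientAt hv hs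
  rw [(hg x hx).gradient, (hg' x hx).gradient]
  by_contra! hne
  -- A nonzero gradient prevents a function from vanishing on any nonempty open part of the element.
  -- Applied to `u`, and then to `v` on the open set `{u ≠ 0}`, this yields a point where neither
  -- vanishes.
  have hzero : ∀ {z : E d → ℝ} {g : E d}, g ≠ 0 →
      (∀ x ∈ interior (convexHull ℝ (s : Set (E d))), HasGradientAt z g x) →
      ∀ O : Set (E d), IsOpen O → O ⊆ interior (convexHull ℝ (s : Set (E d))) → O.Nonempty →
      ∃ y ∈ O, z y ≠ 0 := by
    intro z g hg0 hz O hO hOs ⟨y, hy⟩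
    by_contra! h0
    refine hg0 (((hz y (hOs hy)).unique ?_))
    refine (hasGradientAt_const y (0 : ℝ)).congr_of_eventuallyEq ?_
    filter_upwards [hO.mem_nhds hy] with y' hy' using h0 y' hy'
  obtain ⟨y, hy, huy⟩ := hzero hne.1 hg _ isOpen_interior subset_rfl ⟨x, hx⟩
  obtain ⟨y', hy', hvy⟩ := hzero hne.2 hg'
    (interior (convexHull ℝ (s : Set (E d))) ∩ {y | u y ≠ 0})
    (isOpen_interior.inter (isOpen_ne_fun hu.1 continuous_const)) inter_subset_left ⟨y, hy, huy⟩
  exact (h y').elim hy'.2 hvy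

/-- On a bounded set `f` is integrable because `p / (p - 1) ≥ 1`, and `v` is bounded, being
continuous with compact support. -/
theorem integrableOn_mul_of_memLp (hΩ : Bornology.IsBounded Ω) {p : ℝ} (hp : 1 < p)
    {f : E d → ℝ} (hf : MemLp f (ENNReal.ofReal (p / (p - 1))) (volume.restrict Ω))
    (hv : v ∈ T.S) : IntegrableOn (fun x => f x * v x) Ω := by
  have : IsFiniteMeasure (volume.restrict Ω) := ⟨by simpa using hΩ.measure_lt_top⟩
  have hf1 : Integrable f (volume.restrict Ω) := by
    refine hf.integrable ?_
    rw [ENNReal.one_le_ofReal, le_div_iff₀ (by linarith)]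
    linarith
  have hcpt : HasCompactSupport v := by
    refine HasCompactSupport.intro (K := closure Ω) hΩ.isCompact_closure fun x hx => ?_
    exact hv.2.1 x fun h => hx (subset_closure h)
  obtain ⟨C, hC⟩ := hcpt.exists_bound_of_continuous hv.1
  exact hf1.mul_bdd (c := C) hv.1.aestronglyMeasurable (Filter.Eventually.of_forall hC)

end Triangulation

end PLap

/-! ### Pointwise Bregman inequalities for the power of the norm -/

/-- For `p ≥ 2` the Bregman distance of `‖·‖^p / p` dominates a weighted quadratic. -/
theorem bregman_norm_rpow_ge_quadratic {V : Type*} [NormedAddCommGroup V] [InnerProductSpace ℝ V]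
    {p : ℝ} (hp : 2 ≤ p) (ξ η : V) :
    ‖η‖ ^ (p - 2) * ‖ξ - η‖ ^ 2 / 2 ≤
      1 / p * ‖ξ‖ ^ p - 1 / p * ‖η‖ ^ p - ‖η‖ ^ (p - 2) * inner ℝ η (ξ - η) := by
  have h2 : ‖ξ - η‖ ^ 2 = ‖ξ‖ ^ 2 - 2 * inner ℝ η ξ + ‖η‖ ^ 2 := by
    rw [norm_sub_sq_real, real_inner_comm]
  rw [inner_sub_right, real_inner_self_eq_norm_sq, h2]
  have hb := norm_nonneg η
  have ha := norm_nonneg ξ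
  have hp0 : 0 < p := by linarith
  rcases eq_or_lt_of_le hb with hb0 | hb0
  · have : η = 0 := norm_eq_zero.1 hb0.symm
    subst this
    -- At `η = 0` the weight `0 ^ (p - 2)` equals 1 for `p = 2` and 0 for `p > 2`.
    rcases eq_or_lt_of_le hp with rfl | hp2
    · simp only [norm_zero]; norm_num; linarith
    · simp only [norm_zero, Real.zero_rpow (by linarith : p - 2 ≠ 0), Real.zero_rpow hp0.ne']
      have := Real.rpow_nonneg ha p
      simp only [inner_zero_left]
      have : 0 ≤ 1 / p * ‖ξ‖ ^ p := by positivity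
      linarith
  · set a := ‖ξ‖
    set b := ‖η‖
    set s := inner ℝ η ξ
    -- Bernoulli's inequality with exponent `p / 2 ≥ 1` is convexity in the squared norm: `a^p ≥ b^p
    -- + (p/2) b^(p-2) (a² - b²)`. The claim follows from `a² - b² = ‖ξ - η‖² + 2⟨η, ξ - η⟩`.
    have key := one_add_mul_self_le_rpow_one_add (s := a ^ 2 / b ^ 2 - 1) (p := p / 2)
      (by have : 0 ≤ a ^ 2 / b ^ 2 := by positivity
          linarith) (by linarith)
    have e1 : (1 + (a ^ 2 / b ^ 2 - 1)) ^ (p / 2) = a ^ p / b ^ p := by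
      rw [add_sub_cancel, Real.div_rpow (by positivity) (by positivity),
        ← Real.rpow_natCast, ← Real.rpow_natCast, ← Real.rpow_mul ha, ← Real.rpow_mul hb]
      norm_num [mul_div_cancel₀]
    have e2 : b ^ p = b ^ (p - 2) * b ^ 2 := by
      rw [← Real.rpow_natCast, ← Real.rpow_add hb0]; norm_num
    have hB : 0 < b ^ (p - 2) := Real.rpow_pos_of_pos hb0 _
    rw [e1, le_div_iff₀ (by positivity), e2] at key
    rw [e2]
    have e3 : (1 + p / 2 * (a ^ 2 / b ^ 2 - 1)) * (b ^ (p - 2) * b ^ 2) =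
        b ^ (p - 2) * (b ^ 2 + p / 2 * (a ^ 2 - b ^ 2)) := by
      field_simp
    rw [e3] at key
    have : 1 / p * (b ^ (p - 2) * (b ^ 2 + p / 2 * (a ^ 2 - b ^ 2))) ≤ 1 / p * a ^ p :=
      mul_le_mul_of_nonneg_left key (by positivity)
    have e4 : 1 / p * (b ^ (p - 2) * (b ^ 2 + p / 2 * (a ^ 2 - b ^ 2))) =
      1 / p * (b ^ (p - 2) * b ^ 2) + b ^ (p - 2) * (a ^ 2 - b ^ 2) / 2 := by
      field_simp
    nlinarith

/-- Two regimes, each giving one entry of the minimum. If `‖ξ‖ ≤ 2p‖η‖`, then `‖ξ - η‖ + ‖η‖ ≤ (2p +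
2)‖η‖` and the quadratic bound suffices. Otherwise the left density is at most `(2‖ξ‖)^p`, and the
threshold `2p` makes the mixed term at most half of `‖ξ‖^p / p`. -/
theorem bregman_norm_rpow_ge_of_two_le {V : Type*} [NormedAddCommGroup V] [InnerProductSpace ℝ V]
    {p : ℝ} (hp : 2 ≤ p) :
    ∃ c : ℝ, 0 < c ∧ ∀ ξ η : V, c * ((‖ξ - η‖ + ‖η‖) ^ (p - 2) * ‖ξ - η‖ ^ 2) ≤
      1 / p * ‖ξ‖ ^ p - 1 / p * ‖η‖ ^ p - ‖η‖ ^ (p - 2) * inner ℝ η (ξ - η) := by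
  have hp0 : 0 < p := by linarith
  refine ⟨min (1 / (2 * p * 2 ^ p)) (1 / (2 * (2 * p + 2) ^ (p - 2))), by positivity,
    fun ξ η => ?_⟩
  have ha := norm_nonneg ξ
  have hb := norm_nonneg η
  have hr := norm_nonneg (ξ - η)
  have htri : ‖ξ - η‖ ≤ ‖ξ‖ + ‖η‖ := norm_sub_le _ _
  rcases le_or_gt ‖ξ‖ (2 * p * ‖η‖) with hab | hab
  · refine le_trans ?_ (bregman_norm_rpow_ge_quadratic hp ξ η)
    have h1 : (‖ξ - η‖ + ‖η‖) ^ (p - 2) ≤ (2 * p + 2) ^ (p - 2) * ‖η‖ ^ (p - 2) := by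
      rw [← Real.mul_rpow (by positivity) hb]
      exact Real.rpow_le_rpow (by positivity) (by linarith) (by linarith)
    have h2 : min (1 / (2 * p * 2 ^ p)) (1 / (2 * (2 * p + 2) ^ (p - 2))) ≤
      1 / (2 * (2 * p + 2) ^ (p - 2)) := min_le_right _ _
    calc _ ≤ 1 / (2 * (2 * p + 2) ^ (p - 2)) *
        ((2 * p + 2) ^ (p - 2) * ‖η‖ ^ (p - 2) * ‖ξ - η‖ ^ 2) := by gcongr
      _ = _ := by field_simp
  · have ha0 : 0 < ‖ξ‖ := lt_of_le_of_lt (by positivity) hab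
    have h2 : min (1 / (2 * p * 2 ^ p)) (1 / (2 * (2 * p + 2) ^ (p - 2))) ≤
      1 / (2 * p * 2 ^ p) := min_le_left _ _
    have hb4 : 4 * ‖η‖ ≤ 2 * p * ‖η‖ := by nlinarith
    have h3 : (‖ξ - η‖ + ‖η‖) ^ (p - 2) * ‖ξ - η‖ ^ 2 ≤ 2 ^ p * ‖ξ‖ ^ p := by
      calc _ ≤ (2 * ‖ξ‖) ^ (p - 2) * (2 * ‖ξ‖) ^ 2 := by
            gcongr
            · linarith
            · linarith
        _ = _ := by
            rw [← Real.mul_rpow (by norm_num) ha, ← Real.rpow_natCast,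
              ← Real.rpow_add (by positivity)]
            norm_num
    have hcs : ‖η‖ ^ (p - 2) * inner ℝ η ξ ≤ 1 / (2 * p) * ‖ξ‖ ^ p := by
      have hK : ‖η‖ ≤ ‖ξ‖ / (2 * p) := by rw [le_div_iff₀ (by positivity)]; linarith
      have hle : ‖ξ‖ / (2 * p) ≤ ‖ξ‖ := div_le_self ha (by linarith)
      calc _ ≤ ‖η‖ ^ (p - 2) * (‖η‖ * ‖ξ‖) := by
            gcongr; exact real_inner_le_norm _ _
        _ ≤ ‖ξ‖ ^ (p - 2) * (‖ξ‖ / (2 * p) * ‖ξ‖) := by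
            gcongr
            linarith
        _ = 1 / (2 * p) * (‖ξ‖ ^ (p - 2) * ‖ξ‖ ^ (2 : ℕ)) := by ring
        _ = _ := by
            rw [← Real.rpow_natCast, ← Real.rpow_add ha0]; norm_num
    have e2 : ‖η‖ ^ p = ‖η‖ ^ (p - 2) * ‖η‖ ^ 2 := by
      rw [← Real.rpow_natCast, ← Real.rpow_add' hb (by push_cast; linarith)]; norm_num
    have h5 : 0 ≤ ‖η‖ ^ (p - 2) * ‖η‖ ^ 2 := by positivity
    have h6 : 1 / p * (‖η‖ ^ (p - 2) * ‖η‖ ^ 2) ≤ ‖η‖ ^ (p - 2) * ‖η‖ ^ 2 :=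
      mul_le_of_le_one_left h5 (by rw [div_le_one hp0]; linarith)
    rw [inner_sub_right, real_inner_self_eq_norm_sq, e2]
    have h7 : 1 / (2 * p) * ‖ξ‖ ^ p = 1 / p * ‖ξ‖ ^ p - 1 / (2 * p) * ‖ξ‖ ^ p := by
      field_simp; norm_num
    calc _ ≤ 1 / (2 * p * 2 ^ p) * (2 ^ p * ‖ξ‖ ^ p) := by gcongr
      _ = 1 / (2 * p) * ‖ξ‖ ^ p := by field_simp
      _ ≤ _ := by rw [h7]; linarith

/-- Uniform convexity of `x ↦ x ^ p / p` on `[0, M]` for `1 < p ≤ 2`. -/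
theorem rpow_sub_tangent_ge {p : ℝ} (hp : 1 < p) (hp2 : p ≤ 2) {a b M : ℝ} (ha : 0 ≤ a)
    (haM : a ≤ M) (hb : 0 < b) (hbM : b < M) :
    (p - 1) * M ^ (p - 2) * (a - b) ^ 2 / 2 ≤
      1 / p * a ^ p - 1 / p * b ^ p - b ^ (p - 1) * (a - b) := by
  set κ := (p - 1) * M ^ (p - 2) with hκ
  have hM : 0 < M := hb.trans hbM
  -- `κ` is the minimum of the second derivative `(p - 1) x^(p-2)` on `(0, M]`, so `g` stays convex;
  -- its tangent inequality at `b` is the claim.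
  set g : ℝ → ℝ := fun x => 1 / p * x ^ p - κ * x ^ 2 / 2 with hg
  have hder : ∀ x : ℝ, HasDerivAt g (x ^ (p - 1) - κ * x) x := by
    intro x
    have h1 := (Real.hasDerivAt_rpow_const (x := x) (p := p) (Or.inr hp.le)).const_mul (1 / p)
    have h2 := (((hasDerivAt_id x).pow 2).const_mul κ).div_const 2
    refine (h1.sub h2).congr_deriv ?_
    have : p ≠ 0 := by linarith
    simp only [id]
    field_simp
    ring
  have hmono : MonotoneOn (deriv g) (interior (Icc 0 M)) := by
    rw [interior_Icc]
    intro x hx y hy hxy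
    rw [(hder x).deriv, (hder y).deriv]
    have hy0 : 0 < y := hy.1
    -- Bernoulli with exponent `p - 1 ≤ 1` bounds the increment of `x^(p-1)` from below by `(p - 1)
    -- y^(p-2) (y - x)`, with no second derivative, which may blow up at 0.
    have hB := rpow_one_add_le_one_add_mul_self (s := x / y - 1) (p := p - 1)
      (by have : 0 ≤ x / y := div_nonneg hx.1.le hy.1.le
          linarith) (by linarith) (by linarith)
    rw [add_sub_cancel, Real.div_rpow hx.1.le hy.1.le, div_le_iff₀ (Real.rpow_pos_of_pos hy0 _)]
      at hB
    have e : y ^ (p - 1) = y ^ (p - 2) * y := by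
      rw [← Real.rpow_add_one hy0.ne']; ring_nf
    have e2 : (1 + (p - 1) * (x / y - 1)) * y ^ (p - 1) =
        y ^ (p - 1) - (p - 1) * y ^ (p - 2) * (y - x) := by
      rw [e]; field_simp; ring
    have h3 : M ^ (p - 2) ≤ y ^ (p - 2) :=
      Real.rpow_le_rpow_of_nonpos hy0 hy.2.le (by linarith)
    have h4 : κ * (y - x) ≤ (p - 1) * y ^ (p - 2) * (y - x) := by
      rw [hκ]; gcongr
    rw [e2] at hB
    linarith
  have hconv : ConvexOn ℝ (Icc 0 M) g :=
    hmono.convexOn_of_deriv (convex_Icc _ _)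
      (fun x _ => (hder x).continuousAt.continuousWithinAt)
      (fun x _ => (hder x).differentiableAt.differentiableWithinAt)
  have main : (b ^ (p - 1) - κ * b) * (a - b) ≤ g a - g b := by
    rcases lt_trichotomy a b with h | h | h
    · have := hconv.slope_le_of_hasDerivAt ⟨ha, haM⟩ ⟨hb.le, hbM.le⟩ h (hder b)
      rw [slope_def_field, div_le_iff₀ (by linarith)] at this
      linarith
    · simp [h]
    · have := hconv.le_slope_of_hasDerivAt ⟨hb.le, hbM.le⟩ ⟨ha, haM⟩ h (hder b)
      rw [slope_def_field, le_div_iff₀ (by linarith)] at this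
      linarith
  simp only [hg] at main
  nlinarith

/-- Splits into a radial and an angular part. With `A = ‖ξ‖‖η‖ - ⟨η, ξ⟩ ≥ 0`, the right side is the
scalar Bregman distance of the norms plus `‖η‖^(p-2) A`, while `‖ξ - η‖² = (‖ξ‖ - ‖η‖)² + 2A`. The
radial part is `rpow_sub_tangent_ge`; the angular one uses `(p - 1) M^(p-2) ≤ ‖η‖^(p-2)`. -/
theorem bregman_norm_rpow_ge_of_le_two {V : Type*} [NormedAddCommGroup V] [InnerProductSpace ℝ V]
    {p : ℝ} (hp : 1 < p) (hp2 : p ≤ 2) (ξ η : V) :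
    (p - 1) / 2 * ((‖ξ - η‖ + ‖η‖) ^ (p - 2) * ‖ξ - η‖ ^ 2) ≤
      1 / p * ‖ξ‖ ^ p - 1 / p * ‖η‖ ^ p - ‖η‖ ^ (p - 2) * inner ℝ η (ξ - η) := by
  have ha := norm_nonneg ξ
  have hb := norm_nonneg η
  have hr := norm_nonneg (ξ - η)
  have hp0 : 0 < p := by linarith
  rcases eq_or_lt_of_le hr with hr0 | hr0
  · have : ξ = η := sub_eq_zero.1 (norm_eq_zero.1 hr0.symm)
    subst this
    simp
  rcases eq_or_lt_of_le hb with hb0 | hb0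
  · have : η = 0 := norm_eq_zero.1 hb0.symm
    subst this
    simp only [sub_zero] at hr0
    simp only [sub_zero, norm_zero, add_zero, inner_zero_left, mul_zero,
      Real.zero_rpow hp0.ne']
    have e : ‖ξ‖ ^ (p - 2) * ‖ξ‖ ^ 2 = ‖ξ‖ ^ p := by
      rw [← Real.rpow_natCast, ← Real.rpow_add hr0]; norm_num
    rw [e]
    have h1 : (p - 1) / 2 ≤ 1 / p := by
      rw [div_le_div_iff₀ (by norm_num) hp0]
      nlinarith
    have h2 := mul_le_mul_of_nonneg_right h1 (Real.rpow_nonneg ha p)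
    linarith
  · set M := ‖ξ - η‖ + ‖η‖
    have haM : ‖ξ‖ ≤ M := by simpa using norm_add_le (ξ - η) η
    have hbM : ‖η‖ < M := lt_add_of_pos_left _ hr0
    have h1 := rpow_sub_tangent_ge hp hp2 ha haM hb0 hbM
    have h2 : ‖ξ - η‖ ^ 2 = ‖ξ‖ ^ 2 - 2 * inner ℝ η ξ + ‖η‖ ^ 2 := by
      rw [norm_sub_sq_real, real_inner_comm]
    have e : ‖η‖ ^ (p - 1) = ‖η‖ ^ (p - 2) * ‖η‖ := by
      rw [← Real.rpow_add_one hb0.ne']; ring_nf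
    have h3 : (p - 1) * M ^ (p - 2) ≤ ‖η‖ ^ (p - 2) := by
      have h4 : M ^ (p - 2) ≤ ‖η‖ ^ (p - 2) :=
        Real.rpow_le_rpow_of_nonpos hb0 hbM.le (by linarith)
      have h5 : 0 ≤ M ^ (p - 2) := by positivity
      nlinarith
    have hcs : 0 ≤ ‖ξ‖ * ‖η‖ - inner ℝ η ξ := by
      have := real_inner_le_norm η ξ; linarith
    rw [inner_sub_right, real_inner_self_eq_norm_sq, h2]
    rw [e] at h1
    have h6 := mul_le_mul_of_nonneg_right h3 hcs
    nlinarith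

/-- The Bregman distance of `‖·‖^p / p` dominates the quasi-norm density. -/
theorem exists_bregman_norm_rpow_ge {V : Type*} [NormedAddCommGroup V] [InnerProductSpace ℝ V]
    {p : ℝ} (hp : 1 < p) :
    ∃ c : ℝ, 0 < c ∧ ∀ ξ η : V, c * ((‖ξ - η‖ + ‖η‖) ^ (p - 2) * ‖ξ - η‖ ^ 2) ≤
      1 / p * ‖ξ‖ ^ p - 1 / p * ‖η‖ ^ p - ‖η‖ ^ (p - 2) * inner ℝ η (ξ - η) := by
  rcases le_total p 2 with h | h
  · exact ⟨(p - 1) / 2, by linarith, bregman_norm_rpow_ge_of_le_two hp h⟩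
  · exact bregman_norm_rpow_ge_of_two_le h

/-! ### Scaling and convexity -/

/-- Scaling of the quasi-norm density along a segment. -/
theorem quasiNorm_density_smul_le {p r b t : ℝ} (hr : 0 ≤ r) (hb : 0 ≤ b)
    (ht : 0 < t) (ht1 : t ≤ 1) :
    (t * r + b) ^ (p - 2) * (t * r) ^ 2 ≤ t ^ min p 2 * ((r + b) ^ (p - 2) * r ^ 2) := by
  rcases eq_or_lt_of_le hr with rfl | hr
  · simp
  -- For `p ≤ 2` the weight is decreasing and `t r + b ≥ t (r + b)`; for `p ≥ 2` it is increasing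
  -- and `t r + b ≤ r + b`.
  rcases le_total p 2 with h | h
  · rw [min_eq_left h]
    have h1 : (t * r + b) ^ (p - 2) ≤ (t * (r + b)) ^ (p - 2) :=
      Real.rpow_le_rpow_of_nonpos (by positivity) (by nlinarith) (by linarith)
    have e : t ^ p = t ^ (p - 2) * t ^ 2 := by
      rw [← Real.rpow_natCast, ← Real.rpow_add ht]; norm_num
    calc _ ≤ (t * (r + b)) ^ (p - 2) * (t * r) ^ 2 := by gcongr
      _ = _ := by rw [Real.mul_rpow ht.le (by positivity), e]; ring
  · rw [min_eq_right h]
    have h1 : (t * r + b) ^ (p - 2) ≤ (r + b) ^ (p - 2) :=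
      Real.rpow_le_rpow (by positivity) (by nlinarith) (by linarith)
    calc _ ≤ (r + b) ^ (p - 2) * (t * r) ^ 2 := by gcongr
      _ = _ := by rw [Real.rpow_ofNat]; ring

theorem norm_rpow_convex {V : Type*} [SeminormedAddCommGroup V] [NormedSpace ℝ V] {p : ℝ}
    (hp : 1 ≤ p) (x y : V) {a b : ℝ} (ha : 0 ≤ a) (hb : 0 ≤ b) (hab : a + b = 1) :
    ‖a • x + b • y‖ ^ p ≤ a * ‖x‖ ^ p + b * ‖y‖ ^ p := by
  calc _ ≤ (a * ‖x‖ + b * ‖y‖) ^ p := by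
        refine Real.rpow_le_rpow (norm_nonneg _) ?_ (by linarith)
        refine (norm_add_le _ _).trans ?_
        rw [norm_smul_of_nonneg ha, norm_smul_of_nonneg hb]
    _ ≤ _ := (convexOn_rpow hp).2 (norm_nonneg x) (norm_nonneg y) ha hb hab

/-- Jensen's inequality for a step of total weight at most one away from a point `x`. -/
theorem ConvexOn.map_add_smul_sum_le {V ι : Type*} [AddCommGroup V] [Module ℝ V] [Fintype ι]
    {s : Set V} {F : V → ℝ} (hF : ConvexOn ℝ s F) {x : V} (hx : x ∈ s) {y : ι → V}
    (hy : ∀ i, x + y i ∈ s) {τ : ℝ} (hτ : 0 ≤ τ) (hτ1 : τ * Fintype.card ι ≤ 1) :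
    x + τ • ∑ i, y i ∈ s ∧ F (x + τ • ∑ i, y i) ≤ F x + τ * ∑ i, (F (x + y i) - F x) := by
  -- The extra index `none` leaves the remaining weight `1 - τ |ι|` at `x` itself.
  set q : Option ι → ℝ := fun o => o.elim (1 - τ * Fintype.card ι) fun _ => τ with hq
  set z : Option ι → V := fun o => o.elim x fun i => x + y i with hz
  have hq0 : ∀ o ∈ Finset.univ, 0 ≤ q o := by
    rintro (_ | i) -
    · simpa [hq] using hτ1
    · exact hτ
  have hq1 : ∑ o, q o = 1 := by simp [hq, Fintype.sum_option, mul_comm]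
  have hzs : ∀ o ∈ Finset.univ, z o ∈ s := by
    rintro (_ | i) -
    · exact hx
    · exact hy i
  have hsum : ∑ o, q o • z o = x + τ • ∑ i, y i := by
    simp only [hq, hz, Fintype.sum_option, Option.elim, smul_add, Finset.sum_add_distrib,
      Finset.smul_sum, Finset.sum_const, Finset.card_univ, sub_smul, one_smul, mul_smul,
      Nat.cast_smul_eq_nsmul]
    rw [← Nat.cast_smul_eq_nsmul ℝ, ← Nat.cast_smul_eq_nsmul ℝ, smul_comm]
    abel
  rw [← hsum]
  refine ⟨hF.1.sum_mem hq0 hq1 hzs, (hF.map_sum_le hq0 hq1 hzs).trans_eq ?_⟩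
  simp only [hq, hz, Fintype.sum_option, Option.elim, smul_eq_mul, ← Finset.mul_sum,
    Finset.sum_sub_distrib, Finset.sum_const, Finset.card_univ, nsmul_eq_mul]
  ring

/-! ### The energy on the finite element space -/

namespace PLap

namespace Triangulation

variable {d : ℕ} {Ω : Set (E d)} {T : Triangulation Ω} {u v : E d → ℝ} {p : ℝ} {f : E d → ℝ}

theorem integrableOn_norm_rpow (hu : u ∈ T.S) (p : ℝ) :
    IntegrableOn (fun x => ‖∇ u x‖ ^ p) Ω :=
  integrableOn_comp_gradient hu hu fun g _ => ‖g‖ ^ p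

theorem integrableOn_rpow_mul_inner (hu : u ∈ T.S) (hv : v ∈ T.S) (p : ℝ) :
    IntegrableOn (fun x => ‖∇ u x‖ ^ (p - 2) * inner ℝ (∇ u x) (∇ v x)) Ω :=
  integrableOn_comp_gradient hu hv fun g g' => ‖g‖ ^ (p - 2) * inner ℝ g g'

theorem convexOn_energy (hp : 1 ≤ p) (hf : ∀ v ∈ T.S, IntegrableOn (fun x => f x * v x) Ω) :
    ConvexOn ℝ (T.S : Set (E d → ℝ)) (energy Ω p f) := by
  refine ⟨T.S.convex, fun u hu v hv a b ha hb hab => ?_⟩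
  have hau := T.S.smul_mem a hu
  have hbv := T.S.smul_mem b hv
  have h1 : ∫ x in Ω, ‖∇ (a • u + b • v) x‖ ^ p ≤
      ∫ x in Ω, (a * ‖∇ u x‖ ^ p + b * ‖∇ v x‖ ^ p) := by
    refine integral_mono_ae (integrableOn_norm_rpow (T.S.add_mem hau hbv) p)
      (((integrableOn_norm_rpow hu p).const_mul a).add
        ((integrableOn_norm_rpow hv p).const_mul b)) ?_
    filter_upwards [ae_gradient_add hau hbv, ae_gradient_smul hu a, ae_gradient_smul hv b]
      with x h1 h2 h3
    rw [h1, h2, h3]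
    exact norm_rpow_convex hp _ _ ha hb hab
  rw [integral_add ((integrableOn_norm_rpow hu p).const_mul a)
    ((integrableOn_norm_rpow hv p).const_mul b), integral_const_mul, integral_const_mul] at h1
  have h2 : ∫ x in Ω, f x * (a • u + b • v) x =
      a * (∫ x in Ω, f x * u x) + b * ∫ x in Ω, f x * v x := by
    rw [← integral_const_mul, ← integral_const_mul,
      ← integral_add ((hf u hu).const_mul a) ((hf v hv).const_mul b)]
    refine integral_congr_ae (Filter.Eventually.of_forall fun x => ?_)
    simp only [Pi.add_apply, Pi.smul_apply, smul_eq_mul]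
    ring
  have h3 := mul_le_mul_of_nonneg_left h1 (by positivity : 0 ≤ 1 / p)
  simp only [energy, smul_eq_mul, h2]
  linarith

/-- The energy is additive over corrections with disjoint supports. -/
theorem energy_add_sum_sub (hf : ∀ v ∈ T.S, IntegrableOn (fun x => f x * v x) Ω) (hu : u ∈ T.S)
    {ι : Type*} (A : Finset ι) {y : ι → E d → ℝ} (hy : ∀ i ∈ A, y i ∈ T.S)
    (hdisj : ∀ i ∈ A, ∀ j ∈ A, i ≠ j → ∀ x, y i x = 0 ∨ y j x = 0) :
    energy Ω p f (u + ∑ i ∈ A, y i) - energy Ω p f u =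
      ∑ i ∈ A, (energy Ω p f (u + y i) - energy Ω p f u) := by
  classical
  have hS := T.S.sum_mem hy
  have hint : ∀ v ∈ T.S, Integrable (fun x => ‖∇ (u + v) x‖ ^ p - ‖∇ u x‖ ^ p)
      (volume.restrict Ω) := fun v hv =>
    (integrableOn_norm_rpow (T.S.add_mem hu hv) p).sub (integrableOn_norm_rpow hu p)
  have hsub : ∀ v ∈ T.S, energy Ω p f (u + v) - energy Ω p f u =
      1 / p * (∫ x in Ω, (‖∇ (u + v) x‖ ^ p - ‖∇ u x‖ ^ p)) - ∫ x in Ω, f x * v x := by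
    intro v hv
    rw [integral_sub (integrableOn_norm_rpow (T.S.add_mem hu hv) p)
      (integrableOn_norm_rpow hu p)]
    have : ∫ x in Ω, f x * (u + v) x = (∫ x in Ω, f x * u x) + ∫ x in Ω, f x * v x := by
      rw [← integral_add (hf u hu) (hf v hv)]
      simp only [Pi.add_apply, mul_add]
    simp only [energy, this]
    ring
  have hgrad : ∀ᵐ x ∂(volume.restrict Ω), ‖∇ (u + ∑ i ∈ A, y i) x‖ ^ p - ‖∇ u x‖ ^ p =
      ∑ i ∈ A, (‖∇ (u + y i) x‖ ^ p - ‖∇ u x‖ ^ p) := by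
    have h1 : ∀ᵐ x ∂(volume.restrict Ω), ∀ i ∈ A, ∇ (u + y i) x = ∇ u x + ∇ (y i) x :=
      (ae_ball_iff (Finset.countable_toSet A)).2 fun i hi => ae_gradient_add hu (hy i hi)
    have h2 : ∀ᵐ x ∂(volume.restrict Ω), ∀ i ∈ A, ∀ j ∈ A, i ≠ j →
        ∇ (y i) x = 0 ∨ ∇ (y j) x = 0 :=
      (ae_ball_iff (Finset.countable_toSet A)).2 fun i hi =>
        (ae_ball_iff (Finset.countable_toSet A)).2 fun j hj => by
          by_cases hij : i = j
          · exact Filter.Eventually.of_forall fun x h => (h hij).elim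
          · filter_upwards [ae_gradient_eq_zero_or (hy i hi) (hy j hj)
              (hdisj i hi j hj hij)] with x hx _ using hx
    filter_upwards [h1, h2, ae_gradient_add hu hS, ae_gradient_sum A hy] with x h1 h2 h3 h4
    have h0 : ∑ i ∈ A, (‖∇ (u + y i) x‖ ^ p - ‖∇ u x‖ ^ p) =
        ∑ i ∈ A, (‖∇ u x + ∇ (y i) x‖ ^ p - ‖∇ u x‖ ^ p) :=
      Finset.sum_congr rfl fun i hi => by rw [h1 i hi]
    rw [h3, h4, h0]
    -- At almost every point at most one correction has a nonzero gradient, so both sides reduce to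
    -- a single term or to zero.
    by_cases hA : ∃ i ∈ A, ∇ (y i) x ≠ 0
    · obtain ⟨i, hi, hne⟩ := hA
      have h5 : ∀ j ∈ A, j ≠ i → ∇ (y j) x = 0 := fun j hj hji =>
        (h2 j hj i hi hji).resolve_right hne
      rw [Finset.sum_eq_single_of_mem i hi h5, Finset.sum_eq_single_of_mem i hi]
      intro j hj hji
      rw [h5 j hj hji, add_zero, sub_self]
    · push Not at hA
      rw [Finset.sum_eq_zero hA, Finset.sum_eq_zero, add_zero, sub_self]
      intro j hj
      rw [hA j hj, add_zero, sub_self]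
  have hfsum : ∫ x in Ω, f x * (∑ i ∈ A, y i) x = ∑ i ∈ A, ∫ x in Ω, f x * y i x := by
    rw [← integral_finsetSum _ fun i hi => hf _ (hy i hi)]
    simp only [Finset.sum_apply, Finset.mul_sum]
  rw [hsub _ hS, integral_congr_ae hgrad, integral_finsetSum _ fun i hi => hint _ (hy i hi),
    hfsum, Finset.mul_sum, ← Finset.sum_sub_distrib]
  exact Finset.sum_congr rfl fun i hi => (hsub _ (hy i hi)).symm

theorem energyDeriv_smul (hv : v ∈ T.S) (t : ℝ) :
    energyDeriv Ω p f u (t • v) = t * energyDeriv Ω p f u v := by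
  have h1 : ∫ x in Ω, ‖∇ u x‖ ^ (p - 2) * inner ℝ (∇ u x) (∇ (t • v) x) =
      ∫ x in Ω, t * (‖∇ u x‖ ^ (p - 2) * inner ℝ (∇ u x) (∇ v x)) := by
    refine integral_congr_ae ?_
    filter_upwards [ae_gradient_smul hv t] with x hx
    rw [hx, inner_smul_right]
    ring
  have h2 : ∫ x in Ω, f x * (t • v) x = t * ∫ x in Ω, f x * v x := by
    rw [← integral_const_mul]
    refine integral_congr_ae (Filter.Eventually.of_forall fun x => ?_)
    simp only [Pi.smul_apply, smul_eq_mul]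
    ring
  rw [energyDeriv, energyDeriv, h1, h2, integral_const_mul]
  ring

theorem energyDeriv_sum (hf : ∀ v ∈ T.S, IntegrableOn (fun x => f x * v x) Ω) (hu : u ∈ T.S)
    {ι : Type*} (A : Finset ι) {y : ι → E d → ℝ} (hy : ∀ i ∈ A, y i ∈ T.S) :
    energyDeriv Ω p f u (∑ i ∈ A, y i) = ∑ i ∈ A, energyDeriv Ω p f u (y i) := by
  have h1 : ∫ x in Ω, ‖∇ u x‖ ^ (p - 2) * inner ℝ (∇ u x) (∇ (∑ i ∈ A, y i) x) =
      ∫ x in Ω, ∑ i ∈ A, ‖∇ u x‖ ^ (p - 2) * inner ℝ (∇ u x) (∇ (y i) x) := by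
    refine integral_congr_ae ?_
    filter_upwards [ae_gradient_sum A hy] with x hx
    rw [hx, inner_sum, Finset.mul_sum]
  have h2 : ∫ x in Ω, f x * (∑ i ∈ A, y i) x = ∑ i ∈ A, ∫ x in Ω, f x * y i x := by
    rw [← integral_finsetSum _ fun i hi => hf _ (hy i hi)]
    simp only [Finset.sum_apply, Finset.mul_sum]
  simp only [energyDeriv]
  rw [h1, h2, integral_finsetSum _ fun i hi => integrableOn_rpow_mul_inner hu (hy i hi) p,
    ← Finset.sum_sub_distrib]

/-- The linear load term cancels, which leaves the integral of the pointwise Bregman distance. -/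
theorem bregman_eq_integral (hf : ∀ v ∈ T.S, IntegrableOn (fun x => f x * v x) Ω)
    (hu : u ∈ T.S) (hv : v ∈ T.S) :
    bregman Ω p f u v = ∫ x in Ω, (1 / p * ‖∇ u x‖ ^ p - 1 / p * ‖∇ v x‖ ^ p -
      ‖∇ v x‖ ^ (p - 2) * inner ℝ (∇ v x) (∇ u x - ∇ v x)) := by
  have huv := T.S.sub_mem hu hv
  have h1 : ∫ x in Ω, ‖∇ v x‖ ^ (p - 2) * inner ℝ (∇ v x) (∇ (u - v) x) =
      ∫ x in Ω, ‖∇ v x‖ ^ (p - 2) * inner ℝ (∇ v x) (∇ u x - ∇ v x) := by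
    refine integral_congr_ae ?_
    filter_upwards [ae_gradient_sub hu hv] with x hx
    rw [hx]
  have h2 : ∫ x in Ω, f x * (u - v) x = (∫ x in Ω, f x * u x) - ∫ x in Ω, f x * v x := by
    rw [← integral_sub (hf u hu) (hf v hv)]
    simp only [Pi.sub_apply, mul_sub]
  have hiu := (integrableOn_norm_rpow hu p).const_mul (1 / p)
  have hiv := (integrableOn_norm_rpow hv p).const_mul (1 / p)
  have hi := hiu.sub hiv
  simp only [Pi.sub_def] at hi
  rw [integral_sub hi (integrableOn_comp_gradient hv hu
    fun g g' => ‖g‖ ^ (p - 2) * inner ℝ g (g' - g)), integral_sub hiu hiv, integral_const_mul,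
    integral_const_mul, bregman, energy, energy, energyDeriv, h1, h2]
  ring

theorem integrableOn_Phi (hu : u ∈ T.S) (hv : v ∈ T.S) : IntegrableOn
    (fun x => (‖∇ (u - v) x‖ + ‖∇ v x‖) ^ (p - 2) * ‖∇ (u - v) x‖ ^ 2) Ω :=
  integrableOn_comp_gradient (T.S.sub_mem hu hv) hv
    fun g g' => (‖g‖ + ‖g'‖) ^ (p - 2) * ‖g‖ ^ 2

theorem Phi_nonneg (Ω : Set (E d)) (p : ℝ) (u v : E d → ℝ) : 0 ≤ Phi Ω p u v :=
  integral_nonneg fun x => by positivity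

/-- The Bregman distance of the energy dominates `Φ`. -/
theorem mul_Phi_le_bregman (hf : ∀ v ∈ T.S, IntegrableOn (fun x => f x * v x) Ω)
    (hu : u ∈ T.S) (hv : v ∈ T.S) {c : ℝ}
    (hc : ∀ ξ η : E d, c * ((‖ξ - η‖ + ‖η‖) ^ (p - 2) * ‖ξ - η‖ ^ 2) ≤
      1 / p * ‖ξ‖ ^ p - 1 / p * ‖η‖ ^ p - ‖η‖ ^ (p - 2) * inner ℝ η (ξ - η)) :
    c * Phi Ω p u v ≤ bregman Ω p f u v := by
  rw [bregman_eq_integral hf hu hv, Phi, ← integral_const_mul]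
  refine integral_mono_ae ((integrableOn_Phi hu hv).const_mul c) (integrableOn_comp_gradient hu hv
    fun g g' => 1 / p * ‖g‖ ^ p - 1 / p * ‖g'‖ ^ p - ‖g'‖ ^ (p - 2) * inner ℝ g' (g - g')) ?_
  filter_upwards [ae_gradient_sub hu hv] with x hx
  rw [hx]
  exact hc _ _

/-- For `p > 1` the exponent exceeds one, so along the segment towards `u` the `Φ` term is of higher
order in `t` than the linear decrease of the energy. -/
theorem Phi_add_smul_le (hu : u ∈ T.S) (hv : v ∈ T.S) {t : ℝ} (ht : 0 < t) (ht1 : t ≤ 1) :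
    Phi Ω p (v + t • (u - v)) v ≤ t ^ min p 2 * Phi Ω p u v := by
  have huv := T.S.sub_mem hu hv
  rw [Phi, Phi, ← integral_const_mul]
  refine integral_mono_ae (integrableOn_Phi (T.S.add_mem hv (T.S.smul_mem t huv)) hv)
    ((integrableOn_Phi hu hv).const_mul _) ?_
  filter_upwards [ae_gradient_smul huv t] with x hx
  rw [add_sub_cancel_left, hx, norm_smul_of_nonneg ht.le]
  exact quasiNorm_density_smul_le (norm_nonneg _) (norm_nonneg _) ht ht1

end Triangulation

/-! ### One step of the additive Schwarz method -/

namespace TwoLevel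

variable {d : ℕ} {Ω : Set (E d)} (D : TwoLevel Ω) {p : ℝ} {f ψ : E d → ℝ}

theorem convex_Kh (ψ : E d → ℝ) : Convex ℝ (D.Kh ψ) := by
  intro u hu v hv a b ha hb hab
  refine ⟨D.V.add_mem (D.V.smul_mem a hu.1) (D.V.smul_mem b hv.1), ?_⟩
  filter_upwards [hu.2, hv.2] with x h1 h2
  have : ψ x = a * ψ x + b * ψ x := by rw [← add_mul, hab, one_mul]
  rw [this]
  simp only [Pi.add_apply, Pi.smul_apply, smul_eq_mul]
  gcongr

/-- Giving every subdomain its own color shows that the infimum is over a nonempty set, hence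
attained, and not the default value 0. -/
theorem exists_coloring : ∃ col : Fin D.N → Fin D.numColors, ∀ k l, k ≠ l → col k = col l →
    Disjoint (D.enlarged k) (D.enlarged l) :=
  Nat.sInf_mem (s := {c | ∃ col : Fin D.N → Fin c, ∀ k l, k ≠ l → col k = col l →
    Disjoint (D.enlarged k) (D.enlarged l)}) ⟨D.N, id, fun _ _ h h' => (h h').elim⟩

/-- The sum of admissible corrections with disjoint supports is admissible. -/
theorem add_sum_mem_Kh {u : E d → ℝ} (hu : u ∈ D.Kh ψ) {ι : Type*} (A : Finset ι)
    {y : ι → E d → ℝ} (hy : ∀ i ∈ A, y i ∈ D.V) (hyK : ∀ i ∈ A, u + y i ∈ D.Kh ψ)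
    (hdisj : ∀ i ∈ A, ∀ j ∈ A, i ≠ j → ∀ x, y i x = 0 ∨ y j x = 0) :
    u + ∑ i ∈ A, y i ∈ D.Kh ψ := by
  refine ⟨D.V.add_mem hu.1 (D.V.sum_mem hy), ?_⟩
  have h1 : ∀ᵐ x ∂(volume.restrict Ω), ∀ i ∈ A, ψ x ≤ (u + y i) x :=
    (ae_ball_iff (Finset.countable_toSet A)).2 fun i hi => (hyK i hi).2
  filter_upwards [hu.2, h1] with x h0 h1
  rw [Pi.add_apply, Finset.sum_apply]
  by_cases hA : ∃ i ∈ A, y i x ≠ 0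
  · obtain ⟨i, hi, hne⟩ := hA
    rw [Finset.sum_eq_single_of_mem i hi fun j hj hji =>
      (hdisj j hj i hi hji x).resolve_right hne]
    exact h1 i hi
  · push Not at hA
    rw [Finset.sum_eq_zero hA, add_zero]
    exact h0

/-- A damped additive step is admissible, and the energy decreases by at least the damped sum of
the decreases of the local steps. -/
theorem add_smul_sum_mem_and_energy_le (hΩ : IsLipschitzDomain Ω) (hp : 1 ≤ p)
    (hf : ∀ v ∈ D.V, IntegrableOn (fun x => f x * v x) Ω) {u : E d → ℝ} (hu : u ∈ D.Kh ψ)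
    {y : Fin (D.N + 1) → E d → ℝ} (hy : ∀ k, y k ∈ D.localSpace k)
    (hyK : ∀ k, u + y k ∈ D.Kh ψ) {τ : ℝ} (hτ : 0 ≤ τ) (hτ1 : τ ≤ D.tau0) :
    u + τ • ∑ k, y k ∈ D.Kh ψ ∧ energy Ω p f (u + τ • ∑ k, y k) ≤
      energy Ω p f u + τ * ∑ k, (energy Ω p f (u + y k) - energy Ω p f u) := by
  classical
  obtain ⟨col, hcol⟩ := D.exists_coloring
  have hyV := fun k => D.localSpace_le hΩ k (hy k)
  -- One block for the coarse correction and one per color: their number is `1 / τ₀`, so `τ ≤ τ₀` is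
  -- the weight condition in Jensen's inequality.
  set W : Fin (D.numColors + 1) → E d → ℝ :=
    Fin.cons (y 0) fun c => ∑ k with col k = c, y k.succ with hW
  have hdisj : ∀ c, ∀ i ∈ Finset.univ.filter (col · = c), ∀ j ∈ Finset.univ.filter (col · = c),
      i ≠ j → ∀ x, y i.succ x = 0 ∨ y j.succ x = 0 := by
    intro c i hi j hj hij x
    simp only [Finset.mem_filter, Finset.mem_univ, true_and] at hi hj
    by_cases hx : x ∈ D.enlarged i
    · exact Or.inr ((hy j.succ).2.1 x
        (disjoint_left.1 (hcol i j hij (hi.trans hj.symm)) hx))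
    · exact Or.inl ((hy i.succ).2.1 x hx)
  have hWK : ∀ c, u + W c ∈ D.Kh ψ := by
    refine Fin.cases (hyK 0) fun c => ?_
    exact D.add_sum_mem_Kh hu _ (fun i _ => hyV _) (fun i _ => hyK _) (hdisj c)
  have hsum : ∑ c, W c = ∑ k, y k := by
    rw [Fin.sum_univ_succ, Fin.sum_univ_succ]
    simp only [hW, Fin.cons_zero, Fin.cons_succ]
    rw [Finset.sum_fiberwise]
  have hen : ∑ c, (energy Ω p f (u + W c) - energy Ω p f u) =
      ∑ k, (energy Ω p f (u + y k) - energy Ω p f u) := by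
    rw [Fin.sum_univ_succ, Fin.sum_univ_succ]
    simp only [hW, Fin.cons_zero, Fin.cons_succ]
    congr 1
    rw [Finset.sum_congr rfl fun c _ => Triangulation.energy_add_sum_sub hf hu.1 _
      (fun i _ => hyV _) (hdisj c), Finset.sum_fiberwise]
  have hconv : ConvexOn ℝ (D.Kh ψ) (energy Ω p f) :=
    (Triangulation.convexOn_energy (T := D.fine) hp hf).subset (fun v hv => hv.1) (D.convex_Kh ψ)
  have := hconv.map_add_smul_sum_le hu hWK hτ (by
    rw [tau0, le_div_iff₀ (by positivity)] at hτ1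
    simpa using hτ1)
  rwa [hsum, hen] at this

/-- Linear convergence of a single step with rate `1 - τ t` for every `t` compatible with the
constant of the stable decomposition. -/
theorem energy_step_le (hΩ : IsLipschitzDomain Ω) (hp : 1 ≤ p)
    (hf : ∀ v ∈ D.V, IntegrableOn (fun x => f x * v x) Ω) {μ C₀ : ℝ}
    (hμ : ∀ u ∈ D.V, ∀ v ∈ D.V, μ * Phi Ω p u v ≤ bregman Ω p f u v)
    (hC₀ : 0 < C₀) (hD : D.StableDecomposition p f ψ C₀)
    {us u : E d → ℝ} (hus : us ∈ D.Kh ψ) (hu : u ∈ D.Kh ψ)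
    {y : Fin (D.N + 1) → E d → ℝ} (hy : ∀ k, D.IsLocalCorrection p f ψ u k (y k))
    {τ : ℝ} (hτ : 0 ≤ τ) (hτ1 : τ ≤ D.tau0) {t : ℝ} (ht : 0 < t) (ht1 : t ≤ 1)
    (htC : C₀ * t ^ min p 2 ≤ t * μ) :
    energy Ω p f (u + τ • ∑ k, y k) - energy Ω p f us ≤
      (1 - τ * t) * (energy Ω p f u - energy Ω p f us) := by
  have hstep := (D.add_smul_sum_mem_and_energy_le hΩ hp hf hu (fun k => (hy k).1)
    (fun k => (hy k).2.1) hτ hτ1).2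
  have hz := D.V.sub_mem hus.1 hu.1
  have hv : u + t • (us - u) ∈ D.Kh ψ := by
    have := (D.convex_Kh ψ).add_smul_sub_mem hu hus ⟨ht.le, ht1⟩
    exact this
  -- The point decomposed is the partial step `u + t (us - u)`, not `us`; this leaves `t` free to
  -- balance the two terms.
  obtain ⟨w, hw, hws, hwK, hwb⟩ := hD _ hv _ hu
  rw [add_sub_cancel_left] at hws
  have hloc : ∑ k, (energy Ω p f (u + y k) - energy Ω p f u) ≤
      t * energyDeriv Ω p f u (us - u) + C₀ * Phi Ω p (u + t • (us - u)) u := by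
    calc _ ≤ ∑ k, (energy Ω p f (u + w k) - energy Ω p f u) :=
          Finset.sum_le_sum fun k _ => sub_le_sub_right ((hy k).2.2 _ (hw k) (hwK k)) _
      _ = ∑ k, (energyDeriv Ω p f u (w k) + bregman Ω p f (u + w k) u) := by
          refine Finset.sum_congr rfl fun k _ => ?_
          rw [bregman, add_sub_cancel_left]
          ring
      _ = energyDeriv Ω p f u (t • (us - u)) + ∑ k, bregman Ω p f (u + w k) u := by
          rw [Finset.sum_add_distrib, hws, Triangulation.energyDeriv_sum hf hu.1 _
            fun k _ => D.localSpace_le hΩ k (hw k)]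
      _ ≤ _ := by
          rw [Triangulation.energyDeriv_smul hz]
          gcongr
  have hPhi := Triangulation.Phi_add_smul_le (p := p) hus.1 hu.1 ht ht1
  have hPhi0 := Triangulation.Phi_nonneg Ω p us u
  have hb := hμ _ hus.1 _ hu.1
  have h1 : C₀ * Phi Ω p (u + t • (us - u)) u ≤ t * bregman Ω p f us u :=
    calc _ ≤ C₀ * (t ^ min p 2 * Phi Ω p us u) := by gcongr
      _ = C₀ * t ^ min p 2 * Phi Ω p us u := by ring
      _ ≤ t * μ * Phi Ω p us u := by gcongr
      _ = t * (μ * Phi Ω p us u) := by ring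
      _ ≤ _ := by gcongr
  -- By definition of the Bregman distance, the linear term and `D_F(us, u)` add up to the exact
  -- energy difference.
  have h2 : t * energyDeriv Ω p f u (us - u) + t * bregman Ω p f us u =
      - (t * (energy Ω p f u - energy Ω p f us)) := by
    rw [bregman]; ring
  have h3 := mul_le_mul_of_nonneg_left (hloc.trans (by linarith [h1, h2] :
    _ ≤ -(t * (energy Ω p f u - energy Ω p f us)))) hτ
  nlinarith

end TwoLevel

/-! ### The explicit rate -/

/-- The rate with the explicit constants is implied by the one with an optimized step. -/
theorem rate_le {p τ μ C₀ : ℝ} (hp : 1 < p) (hτ : 0 < τ) (hτ1 : τ ≤ 1) (hμ : 0 < μ)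
    (hC₀ : 0 < C₀) :
    (1 - 1 / min p 2) *
      min τ ((τ ^ (max p 2 - 1) * μ / (2 ^ |p - 2| * C₀)) ^ (1 / (min p 2 - 1))) ≤
      τ * min 1 ((μ / C₀) ^ (1 / (min p 2 - 1))) := by
  have hq : 1 < min p 2 := lt_min hp (by norm_num)
  have hq' : 0 < min p 2 - 1 := by linarith
  have hfac : 1 - 1 / min p 2 ≤ 1 := by
    have : 0 < 1 / min p 2 := by positivity
    linarith
  refine (mul_le_of_le_one_left (by positivity) hfac).trans ?_
  rw [mul_min_of_nonneg _ _ hτ.le, mul_one]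
  refine min_le_min le_rfl ?_
  -- Since `τ ≤ 1`, the power of `τ` may be replaced by `min p 2 - 1`, from which the root extracts
  -- exactly one factor `τ`. The factors `2^|p-2|` and `1 - 1 / min p 2` only weaken the rate.
  have hexp : min p 2 - 1 ≤ max p 2 - 1 := by linarith [min_le_max (a := p) (b := 2)]
  have h1 : τ ^ (max p 2 - 1) ≤ τ ^ (min p 2 - 1) :=
    Real.rpow_le_rpow_of_exponent_ge hτ hτ1 hexp
  have h2 : (1 : ℝ) ≤ 2 ^ |p - 2| := Real.one_le_rpow (by norm_num) (abs_nonneg _)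
  calc _ ≤ (τ ^ (min p 2 - 1) * (μ / C₀)) ^ (1 / (min p 2 - 1)) := by
        refine Real.rpow_le_rpow (by positivity) ?_ (by positivity)
        rw [mul_div_assoc]
        gcongr
        exact le_mul_of_one_le_left hC₀.le h2
    _ = _ := by
        rw [Real.mul_rpow (by positivity) (by positivity), ← Real.rpow_mul hτ.le,
          mul_one_div_cancel hq'.ne', Real.rpow_one]

/-- The optimized step length is compatible with the stable decomposition. -/
theorem stepLength_spec {q μ C₀ : ℝ} (hq : 1 < q) (hμ : 0 < μ) (hC₀ : 0 < C₀) :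
    C₀ * min 1 ((μ / C₀) ^ (1 / (q - 1))) ^ q ≤ min 1 ((μ / C₀) ^ (1 / (q - 1))) * μ := by
  set t := min 1 ((μ / C₀) ^ (1 / (q - 1)))
  have hq' : 0 < q - 1 := by linarith
  have ht : 0 < t := by positivity
  have h1 : t ^ (q - 1) ≤ μ / C₀ := by
    calc _ ≤ ((μ / C₀) ^ (1 / (q - 1))) ^ (q - 1) :=
          Real.rpow_le_rpow ht.le (min_le_right _ _) hq'.le
      _ = _ := by
          rw [← Real.rpow_mul (by positivity), one_div_mul_cancel hq'.ne', Real.rpow_one]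
  have e : t ^ q = t ^ (q - 1) * t := by
    rw [← Real.rpow_add_one ht.ne', sub_add_cancel]
  rw [le_div_iff₀ hC₀] at h1
  rw [e]
  nlinarith

end PLap

theorem theorem4p5 {d : ℕ} (hd : d = 2 ∨ d = 3) {Ω : Set (PLap.E d)}
    (hΩ : PLap.IsLipschitzDomain Ω) {p : ℝ} (hp : 1 < p) {f ψ : PLap.E d → ℝ}
    (hf : MemLp f (ENNReal.ofReal (p / (p - 1))) (volume.restrict Ω))
    (hψ : ContinuousOn ψ (closure Ω)) :
    -- the constant `μ_Φ` exists and can be chosen independently of the triangulation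
    (∃ μ : ℝ, 0 < μ ∧ ∀ T : PLap.Triangulation Ω, ∀ u ∈ T.S, ∀ v ∈ T.S,
      μ * PLap.Phi Ω p u v ≤ PLap.bregman Ω p f u v) ∧
    -- for every such constant the method converges linearly with the stated rate
    (∀ (D : PLap.TwoLevel Ω) (μ : ℝ), 0 < μ →
      (∀ u ∈ D.V, ∀ v ∈ D.V, μ * PLap.Phi Ω p u v ≤ PLap.bregman Ω p f u v) →
      ∀ C₀ : ℝ, 0 < C₀ → D.StableDecomposition p f ψ C₀ →
      ∀ uStar : PLap.E d → ℝ, D.IsSolution p f ψ uStar →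
      ∀ τ : ℝ, 0 < τ → τ ≤ D.tau0 →
      ∀ (u : ℕ → PLap.E d → ℝ) (w : ℕ → Fin (D.N + 1) → PLap.E d → ℝ),
      D.IsSchwarzSequence p f ψ τ u w →
      (∀ n, u n ∈ D.Kh ψ) ∧
      ∃ ρ : ℝ, ρ = 1 - (1 - 1 / min p 2) *
          min τ ((τ ^ (max p 2 - 1) * μ / (2 ^ |p - 2| * C₀)) ^ (1 / (min p 2 - 1))) ∧
        ρ < 1 ∧
        ∀ n, PLap.energy Ω p f (u (n + 1)) - PLap.energy Ω p f uStar ≤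
          ρ * (PLap.energy Ω p f (u n) - PLap.energy Ω p f uStar)) := by
  have hfS : ∀ (T : PLap.Triangulation Ω), ∀ v ∈ T.S, IntegrableOn (fun x => f x * v x) Ω :=
    fun T v hv => PLap.Triangulation.integrableOn_mul_of_memLp hΩ.isBounded hp hf hv
  refine ⟨?_, ?_⟩
  -- The constant is the pointwise one, fixed before any triangulation is chosen.
  · obtain ⟨c, hc, h⟩ := exists_bregman_norm_rpow_ge (V := PLap.E d) hp
    exact ⟨c, hc, fun T u hu v hv => PLap.Triangulation.mul_Phi_le_bregman (hfS T) hu hv h⟩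
  · intro D μ hμ hμD C₀ hC₀ hD us hus τ hτ hτ1 u w hseq
    have hK : ∀ n, u n ∈ D.Kh ψ := by
      intro n
      induction n with
      | zero => exact hseq.init
      | succ n ih =>
        rw [hseq.update n]
        exact (D.add_smul_sum_mem_and_energy_le hΩ hp.le (hfS D.fine) ih
          (fun k => (hseq.correction n k).1) (fun k => (hseq.correction n k).2.1) hτ.le hτ1).1
    have hq : 1 < min p 2 := lt_min hp (by norm_num)
    have hτ2 : τ ≤ 1 := hτ1.trans (div_le_one_of_le₀ (by simp) (by positivity))
    refine ⟨hK, _, rfl, ?_, fun n => ?_⟩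
    · have h1 : 0 < 1 - 1 / min p 2 := by
        rw [sub_pos, div_lt_one (by linarith)]
        exact hq
      have : 0 < (1 - 1 / min p 2) *
          min τ ((τ ^ (max p 2 - 1) * μ / (2 ^ |p - 2| * C₀)) ^ (1 / (min p 2 - 1))) := by
        positivity
      linarith
    · rw [hseq.update n]
      refine (D.energy_step_le hΩ hp.le (hfS D.fine) hμD hC₀ hD hus.1 (hK n) (hseq.correction n)
        hτ.le hτ1 (t := min 1 ((μ / C₀) ^ (1 / (min p 2 - 1)))) (by positivity)
        (min_le_left _ _) (PLap.stepLength_spec hq hμ hC₀)).trans ?_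
      -- Minimality of `us` makes the energy error nonnegative, so the factor `1 - τ t` may be
      -- enlarged to `ρ`.
      refine mul_le_mul_of_nonneg_right ?_ (sub_nonneg.2 (hus.2 _ (hK n)))
      exact sub_le_sub_left (PLap.rate_le hp hτ hτ2 hμ hC₀) 1
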